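/- \textbf{Setting.} Let $V$ be a finite set, let $c, N \ge 0$ be integers, and let $H = A_1 + \cdots + A_c$ be a sum graph on $V$: each atom $A_j \in \mathbb{C}^{V \times V}$ is a Hermitian matrix (for instance the adjacency matrix of a simple undirected graph on $V$). Let $\pi \colon S_N \to \mathrm{U}(d)$ be a unitary matrix representation isomorphic to one of the following three representations of the symmetric group: the sign representation $\mathtt{sgn}$ on $\mathbb{C}$; the permutation representation $\mathtt{perm}$ on $\mathbb{C}^N$, in which $\sigma e_i = e_{\sigma(i)}$; the standard representation $\mathtt{std}$, i.e. the restriction of $\mathtt{perm}$ to the vectors in $\mathbb{C}^N$ with coordinate sum $0$. For $Q \in S_N^V$ put $\pi^{\boxtimes V}(Q) = \sum_{v \in V} |v\rangle\langle v| \otimes \pi(Q(v))$ and, for $A\in\mathbb{C}^{V\times V}$, $\mathrm{Adj}_{Q,\pi}(A) = \pi^{\boxtimes V}(Q)^\dagger\,(A \otimes I_d)\,\pi^{\boxtimes V}(Q)$. For a bit $b$ and $i<j$ let $\mathrm{Swap}_{ij}(b)$ be the transposition $(i\,j)$ if $b = 1$ and the identity if $b = 0$. For $x \in \{0,1\}^{\binom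 N2}$, with bits indexed by the pairs $1 \le i<j \le N$, let \[ \mathrm{Perm}(x) = \prod_{i=1}^{N-1}\prod_{j=i+1}^{N} \mathrm{Swap}_{ij}(x_{ij}) \in S_N \] (product taken from left to right in the lexicographic order of the pairs). Let $\mathrm{LiftEnc}_{N,V} = \bigl(\{0,1\}^{\binom N2}\bigr)^V$; for $y \in \mathrm{LiftEnc}_{N,V}$ let $\mathrm{Potential}(y) \in S_N^V$ be given by $v \mapsto \mathrm{Perm}(y_v)$. For $z = (z_1,\dots,z_c) \in \mathrm{LiftEnc}_{N,V}^c$ define the $\pi$-lifted adjacency matrix \[ \mathrm{Adj}_{z,\pi}(H) = \sum_{j=1}^c \mathrm{Adj}_{\mathrm{Potential}(z_j),\pi}(A_j), \] and let $p_z(x) = \det\bigl(x I - \mathrm{Adj}_{z,\pi}(H)\bigr)$ be its characteristic polynomial. A polynomial is called real-rooted if it is nonzero, has real coefficients, and all its complex roots are real. A family $(p_s)_{s \in \{0,1\}^m}$ of real-rooted polynomials is an interlacing family if, for every product distribution $\mathcal D$ on $\{0,1\}^m$ (the bits are independent, each Bernoulli with its own arbitrary parameter in $[0,1]$), the coefficientwise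 expectation $\mathbb{E}_{s \sim \mathcal D}[p_s]$ is real-rooted. \textbf{Theorem.} The family $(p_z)_{z \in \mathrm{LiftEnc}_{N,V}^c}$, where $\mathrm{LiftEnc}_{N,V}^c$ is identified with $\{0,1\}^m$, $m = c\,|V|\binom N2$, is an interlacing family. That is, every $p_z$ is real-rooted, and $\mathbb{E}_{z \sim \mathcal D}[p_z]$ is real-rooted for every product distribution $\mathcal D$ on $\mathrm{LiftEnc}_{N,V}^c$. -/

import Mathlib

open Polynomial
open scoped Kronecker Matrix

noncomputable section

/-! ### Real-rootedness, product distributions and interlacing families -/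

/-- A nonzero polynomial with real coefficients, all of whose complex roots are real. -/
def RealRooted (p : ℂ[X]) : Prop :=
  p ≠ 0 ∧ (∀ k, (p.coeff k).im = 0) ∧ ∀ z : ℂ, p.IsRoot z → z.im = 0

/-- The probability of the binary string `s` when its bits are independent and bit `i` is
Bernoulli with parameter `b i`. -/
def bernoulliProdWeight {ι : Type*} [Fintype ι] (b : ι → unitInterval) (s : ι → Bool) : ℝ :=
  ∏ i, if s i then (b i : ℝ) else 1 - (b i : ℝ)

/-- The (coefficientwise) expectation of the random polynomial `F s`, when `s` is drawn from the
product distribution with Bernoulli parameters `b`. -/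
def expectedPoly {ι : Type*} [Fintype ι] [DecidableEq ι] (b : ι → unitInterval)
    (F : (ι → Bool) → ℂ[X]) : ℂ[X] :=
  ∑ s : ι → Bool, C ((bernoulliProdWeight b s : ℝ) : ℂ) * F s

/-- A family of real-rooted polynomials indexed by binary strings (with bits labelled by the
finite set `ι`) is an interlacing family if its expectation under every product distribution is
real-rooted. -/
structure IsInterlacingFamily {ι : Type*} [Fintype ι] [DecidableEq ι]
    (F : (ι → Bool) → ℂ[X]) : Prop where
  realRooted : ∀ s, RealRooted (F s)
  realRooted_expectedPoly : ∀ b : ι → unitInterval, RealRooted (expectedPoly b F)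

/-! ### Sum graphs -/

/-- A sum graph `H = A₁ + ⋯ + A_c` on the vertex set `V`: a sequence of atoms, each a weighted
undirected graph given by its Hermitian adjacency matrix. -/
structure SumGraph (V : Type*) (c : ℕ) where
  /-- The adjacency matrices of the atoms. -/
  atom : Fin c → Matrix V V ℂ
  isHermitian : ∀ j, (atom j).IsHermitian

/-! ### The sign, permutation and standard representations of the symmetric group -/

/-- The one-dimensional sign representation. -/
def sgnRep (N : ℕ) : Representation ℂ (Equiv.Perm (Fin N)) ℂ where
  toFun σ := ((Equiv.Perm.sign σ : ℤ) : ℂ) • LinearMap.id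
  map_one' := by ext; simp
  map_mul' σ τ := by ext; simp [mul_comm]

/-- The permutation representation: `σ` sends the basis vector `e i` to `e (σ i)`. -/
def permRep (N : ℕ) : Representation ℂ (Equiv.Perm (Fin N)) (Fin N → ℂ) where
  toFun σ := LinearMap.funLeft ℂ ℂ (σ⁻¹ : Equiv.Perm (Fin N))
  map_one' := by ext; simp [LinearMap.funLeft]
  map_mul' σ τ := by ext; simp [LinearMap.funLeft]

/-- The vectors with coordinate sum zero, as a subrepresentation of the permutation
representation. -/
def sumZeroSubrep (N : ℕ) : Subrepresentation (permRep N) where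
  toSubmodule := LinearMap.ker (∑ i : Fin N, LinearMap.proj (R := ℂ) (φ := fun _ => ℂ) i)
  apply_mem_toSubmodule σ v hv := by
    simp only [LinearMap.mem_ker, LinearMap.coe_sum, Finset.sum_apply, LinearMap.proj_apply] at *
    rw [← hv]
    exact Equiv.sum_comp (σ⁻¹ : Equiv.Perm (Fin N)) v

/-- The standard representation. -/
def stdRep (N : ℕ) :
    Representation ℂ (Equiv.Perm (Fin N)) (sumZeroSubrep N).toSubmodule :=
  (sumZeroSubrep N).toRepresentation

/-- The representation on `ℂ^d` given by a unitary matrix representation. -/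
def unitaryRep {Γ : Type*} [Group Γ] {d : ℕ} (π : Γ →* Matrix.unitaryGroup (Fin d) ℂ) :
    Representation ℂ Γ (Fin d → ℂ) where
  toFun g := Matrix.toLin' (π g : Matrix (Fin d) (Fin d) ℂ)
  map_one' := by simp; rfl
  map_mul' g h := by simp [Matrix.toLin'_mul]; rfl

/-- `π` is one of `sgn`, `std`, `perm`, written in an arbitrary orthonormal basis, i.e. a unitary
matrix representation isomorphic to one of these three. -/
def IsSgnStdOrPerm {N d : ℕ} (π : Equiv.Perm (Fin N) →* Matrix.unitaryGroup (Fin d) ℂ) : Prop :=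
  Nonempty ((unitaryRep π).Equiv (sgnRep N)) ∨
  Nonempty ((unitaryRep π).Equiv (stdRep N)) ∨
  Nonempty ((unitaryRep π).Equiv (permRep N))

/-! ### Lifted adjacency matrices -/

/-- The outer tensor product representation
`π^{⊠V}(Q) = ∑ v, |v⟩⟨v| ⊗ π(Q v)` of `Γ^V`, evaluated at a `Γ`-potential `Q`. -/
def outerTensor {V Γ : Type*} [Fintype V] [DecidableEq V] [Group Γ] {d : ℕ}
    (π : Γ →* Matrix.unitaryGroup (Fin d) ℂ) (Q : V → Γ) : Matrix (V × Fin d) (V × Fin d) ℂ :=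
  ∑ v : V, Matrix.single v v (1 : ℂ) ⊗ₖ (π (Q v) : Matrix (Fin d) (Fin d) ℂ)

/-- The `π`-lifted adjacency matrix of a single atom `A` with respect to a potential `Q`. -/
def liftAdj {V Γ : Type*} [Fintype V] [DecidableEq V] [Group Γ] {d : ℕ}
    (π : Γ →* Matrix.unitaryGroup (Fin d) ℂ) (Q : V → Γ) (A : Matrix V V ℂ) :
    Matrix (V × Fin d) (V × Fin d) ℂ :=
  (outerTensor π Q)ᴴ * (A ⊗ₖ (1 : Matrix (Fin d) (Fin d) ℂ)) * outerTensor π Q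

/-- The `π`-lifted adjacency matrix of a sum graph: lift each atom by its own potential, and add
up the results. -/
def SumGraph.liftAdj {V Γ : Type*} [Fintype V] [DecidableEq V] [Group Γ] {c d : ℕ}
    (H : SumGraph V c) (π : Γ →* Matrix.unitaryGroup (Fin d) ℂ) (Q : Fin c → V → Γ) :
    Matrix (V × Fin d) (V × Fin d) ℂ :=
  ∑ j : Fin c, _root_.liftAdj π (Q j) (H.atom j)

/-! ### Encoding potentials by transpositions -/

/-- The `N.choose 2` pairs `i < j`. -/
abbrev TranspIndex (N : ℕ) : Type := {e : Fin N × Fin N // e.1 < e.2}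

/-- `Swap i j b` is the transposition of `i` and `j` if `b` is true, else the identity. -/
def swapBit {N : ℕ} (i j : Fin N) (b : Bool) : Equiv.Perm (Fin N) :=
  if b then Equiv.swap i j else 1

/-- `Perm x = ∏_{i=1}^{N-1} ∏_{j=i+1}^{N} Swap i j (x_{ij})`, the (noncommutative) product being
taken from left to right in lexicographic order of the pairs `i < j`. -/
def encPerm {N : ℕ} (x : TranspIndex N → Bool) : Equiv.Perm (Fin N) :=
  ((List.finRange N).map fun i =>
    ((List.finRange N).map fun j =>
      if h : i < j then swapBit i j (x ⟨(i, j), h⟩) else 1).prod).prod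

/-- Encodings of one potential: a bit for each vertex and each pair `i < j`. -/
abbrev LiftEnc (N : ℕ) (V : Type*) : Type _ := V → TranspIndex N → Bool

/-- The potential encoded by `y`. -/
def potential {N : ℕ} {V : Type*} (y : LiftEnc N V) : V → Equiv.Perm (Fin N) :=
  fun v => encPerm (y v)

/-- The `π`-lifted adjacency matrix of a sum graph given by an encoding of a potential for each
of its atoms. -/
def SumGraph.liftAdjEnc {V : Type*} [Fintype V] [DecidableEq V] {c N d : ℕ}
    (H : SumGraph V c) (π : Equiv.Perm (Fin N) →* Matrix.unitaryGroup (Fin d) ℂ)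
    (z : Fin c → LiftEnc N V) : Matrix (V × Fin d) (V × Fin d) ℂ :=
  H.liftAdj π fun j => potential (z j)

/-- A binary string with bits labelled by triples (color, vertex, pair `i < j`), read as an
element of `LiftEnc^c`. -/
def encOfBits {V : Type*} {c N : ℕ} (s : Fin c × V × TranspIndex N → Bool) :
    Fin c → LiftEnc N V :=
  fun j v e => s (j, v, e)

end

/-! It suffices that averaging over the bits creates no zero in the upper half-plane; real
coefficients then exclude the lower one. In all three representations a transposition is `1 - w lᵀ`,
so switching on a bit conjugates one lifted atom by a unitary `B` that differs from the identity by
rank at most one. For Hermitian `X` this gives `Bᴴ X B = X + a aᴴ - b bᴴ`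
(`Matrix.conj_one_sub_vecMulVec`): both `X` and `Bᴴ X B` arise from `Y = X + a aᴴ` by subtracting a
positive rank-one matrix. Interlacing in analytic form says that `F(Y - u uᴴ) / F(Y)` is 1 or has
negative imaginary part on the upper half-plane, so no convex combination of the two values
vanishes.

To iterate over dependent, noncommuting factors, one must work with averages of characteristic
polynomials as functions of the whole tuple of matrices. `RankOneStable` records what the ratio
argument needs: the degree and two top coefficients, affineness along positive rank-one directions,
and stability on Hermitian tuples. `RankOneStable.step` shows that these properties survive
averaging over one bit, and induction along the ordered product of swaps finishes the proof. -/

/-! ### Rank-one updates and characteristic polynomials. -/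

/-- The matrix determinant lemma applies over the fraction field, where `M` is invertible. The
intended `R` is `ℂ[X]`, with `M` a characteristic matrix. -/
theorem Matrix.det_add_smul_vecMulVec {n R : Type*} [Fintype n] [DecidableEq n] [CommRing R]
    [IsDomain R] (M : Matrix n n R) (hM : M.det ≠ 0) (u v : n → R) (t : R) :
    (M + t • vecMulVec u v).det = M.det + t * ((M + vecMulVec u v).det - M.det) := by
  have key : ∀ (K : Type _) [Field K] (A : Matrix n n K) (_ : A.det ≠ 0) (u v : n → K) (t : K),
      (A + t • vecMulVec u v).det = A.det + t * ((A + vecMulVec u v).det - A.det) := by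
    intro K _ A hA u v t
    have h1 : ∀ s : K, (A + s • vecMulVec u v).det
        = A.det * (1 + replicateRow Unit v * A⁻¹ * replicateCol Unit (s • u)).det := by
      intro s
      rw [← Matrix.det_add_replicateCol_mul_replicateRow (Ne.isUnit hA), ← smul_vecMulVec,
        vecMulVec_eq Unit]
    have h2 : (A + vecMulVec u v).det = (A + (1 : K) • vecMulVec u v).det := by simp
    rw [h2, h1, h1]
    simp [Matrix.det_unique, replicateCol_smul]
    ring
  apply IsFractionRing.injective R (FractionRing R)
  have h := key (FractionRing R) (M.map (algebraMap R (FractionRing R)))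
    (by
      rw [← RingHom.mapMatrix_apply, ← RingHom.map_det]
      exact fun h0 => hM (IsFractionRing.injective R (FractionRing R) (by simpa using h0)))
    (fun i => algebraMap _ _ (u i)) (fun i => algebraMap _ _ (v i)) (algebraMap _ _ t)
  have e1 : M.map (algebraMap R (FractionRing R)) + (algebraMap R (FractionRing R) t) •
      vecMulVec (fun i => algebraMap R (FractionRing R) (u i))
        (fun i => algebraMap R (FractionRing R) (v i))
      = (M + t • vecMulVec u v).map (algebraMap R (FractionRing R)) := by
    ext i j
    simp only [Matrix.add_apply, Matrix.smul_apply, Matrix.map_apply, vecMulVec_apply, smul_eq_mul,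
      map_add, map_mul]
  have e2 : M.map (algebraMap R (FractionRing R)) +
      vecMulVec (fun i => algebraMap R (FractionRing R) (u i))
        (fun i => algebraMap R (FractionRing R) (v i))
      = (M + vecMulVec u v).map (algebraMap R (FractionRing R)) := by
    ext i j; simp [vecMulVec_apply]
  rw [e1, e2] at h
  simp only [← RingHom.mapMatrix_apply, ← RingHom.map_det] at h
  rw [h]; simp

theorem Matrix.charpoly_add_smul_vecMulVec {n : Type*} [Fintype n] [DecidableEq n]
    (M : Matrix n n ℂ) (u v : n → ℂ) (t : ℂ) :
    (M + t • vecMulVec u v).charpoly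
      = M.charpoly + C t * ((M + vecMulVec u v).charpoly - M.charpoly) := by
  have h1 : ∀ s : ℂ, (M + s • vecMulVec u v).charmatrix = M.charmatrix +
      C s • vecMulVec (fun i => C (-u i)) (fun i => C (v i)) := by
    intro s
    ext1 i j
    simp [Matrix.charmatrix_apply, vecMulVec_apply]
    ring
  have h2 := h1 1
  rw [one_smul, map_one, one_smul] at h2
  unfold Matrix.charpoly
  rw [h1, h2, Matrix.det_add_smul_vecMulVec _ (Matrix.charpoly_monic M).ne_zero]

theorem Matrix.IsHermitian.charpoly_eval_ne_zero {n : Type*} [Fintype n] [DecidableEq n]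
    {M : Matrix n n ℂ} (hM : M.IsHermitian) {z : ℂ} (hz : z.im ≠ 0) :
    M.charpoly.eval z ≠ 0 := by
  rw [hM.charpoly_eq, eval_prod, Finset.prod_ne_zero_iff]
  intro i _ h
  apply hz
  simp only [eval_sub, eval_X, eval_C, sub_eq_zero] at h
  rw [h]; simp

theorem Matrix.IsHermitian.charpoly_coeff_im {n : Type*} [Fintype n] [DecidableEq n]
    {M : Matrix n n ℂ} (hM : M.IsHermitian) (k : ℕ) : (M.charpoly.coeff k).im = 0 := by
  have : M.charpoly = (∏ i, (X - C (hM.eigenvalues i))).map (algebraMap ℝ ℂ) := by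
    rw [hM.charpoly_eq, Polynomial.map_prod]
    simp
  rw [this, coeff_map]
  simp

/-! ### Real pencils without zeros in the upper half-plane. -/

/-- Near infinity on the imaginary axis, `h / q` has negative imaginary part. -/
theorem exists_im_div_neg {n : ℕ} {q h : ℂ[X]} (hq : q.natDegree ≤ n + 1)
    (hq1 : q.coeff (n + 1) = 1) (hh : h.natDegree ≤ n) (hα : 0 < (h.coeff n).re) :
    ∃ z : ℂ, 0 < z.im ∧ (h.eval z / q.eval z).im < 0 := by
  -- With `w = 1/z`, the reversed polynomials give `h(z)/q(z) = w * a(w)/b(w)`, and `a/b` tends to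
  -- the leading coefficient of `h` as `w` tends to 0. Taking `w = -ie` with small `e > 0` then
  -- gives a negative imaginary part.
  set a := reflect n h
  set b := reflect (n + 1) q
  have ha : a.eval 0 = h.coeff n := by rw [← coeff_zero_eq_eval_zero, coeff_reflect]; simp
  have hb : b.eval 0 = 1 := by rw [← coeff_zero_eq_eval_zero, coeff_reflect]; simpa using hq1
  have hc : ContinuousAt (fun e : ℝ => (a.eval (-(e : ℂ) * Complex.I) /
      b.eval (-(e : ℂ) * Complex.I)).re) 0 := by
    apply Complex.continuous_re.continuousAt.comp
    apply ContinuousAt.div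
    · fun_prop
    · fun_prop
    · simp [hb]
  have hpos : ∀ᶠ e : ℝ in nhds 0, 0 < (a.eval (-(e : ℂ) * Complex.I) /
      b.eval (-(e : ℂ) * Complex.I)).re := by
    refine hc.eventually (lt_mem_nhds ?_)
    simpa [ha, hb] using hα
  obtain ⟨e, he, he0⟩ := ((hpos.filter_mono nhdsWithin_le_nhds).and
    (self_mem_nhdsWithin : Set.Ioi (0 : ℝ) ∈ nhdsWithin 0 (Set.Ioi 0))).exists
  have he0 : 0 < e := he0
  have hec : (e : ℂ) ≠ 0 := by exact_mod_cast he0.ne'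
  set w : ℂ := -(e : ℂ) * Complex.I with hw
  have hw0 : w ≠ 0 := by simp [hw, hec]
  have hwi : w⁻¹ = ((e⁻¹ : ℝ) : ℂ) * Complex.I := by
    rw [hw, mul_inv, Complex.inv_I]; push_cast; rw [inv_neg]; ring
  refine ⟨w⁻¹, by rw [hwi]; simpa using he0, ?_⟩
  have : Invertible w⁻¹ := invertibleOfNonzero (inv_ne_zero hw0)
  have r1 := eval₂_reflect_mul_pow (RingHom.id ℂ) w⁻¹ n h hh
  have r2 := eval₂_reflect_mul_pow (RingHom.id ℂ) w⁻¹ (n + 1) q hq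
  simp only [eval₂_id, invOf_eq_inv, inv_inv] at r1 r2
  change a.eval w * _ = _ at r1
  change b.eval w * _ = _ at r2
  have : h.eval w⁻¹ / q.eval w⁻¹ = (a.eval w / b.eval w) * w := by
    rw [← r1, ← r2, pow_succ]
    field_simp
  rw [this, Complex.mul_im, hw]
  simp only [← hw]
  have : w.re = 0 := by simp [hw]
  have h3 : w.im = -e := by simp [hw]
  rw [this, h3]
  nlinarith

/-- A nonzero real value of `h/q` would be a zero of some member of the pencil. By the open mapping
theorem the value 0 is excluded too, so the imaginary part never vanishes and, by connectedness,
keeps the sign it has near infinity. -/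
theorem im_div_neg_of_pencil {n : ℕ} {q h : ℂ[X]} (hq : q.natDegree ≤ n + 1)
    (hq1 : q.coeff (n + 1) = 1) (hh : h.natDegree ≤ n) (hα : 0 < (h.coeff n).re)
    (hst : ∀ t : ℝ, ∀ z : ℂ, 0 < z.im → q.eval z + t * h.eval z ≠ 0) {z : ℂ} (hz : 0 < z.im) :
    (h.eval z / q.eval z).im < 0 := by
  set U : Set ℂ := {z | 0 < z.im} with hU
  have hUc : IsPreconnected U := (convex_halfSpace_im_gt 0).isPreconnected
  have hUo : IsOpen U := isOpen_lt continuous_const Complex.continuous_im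
  have hq0 : ∀ z ∈ U, q.eval z ≠ 0 := fun z hz => by simpa using hst 0 z hz
  set φ : ℂ → ℂ := fun z => h.eval z / q.eval z with hφ
  have hreal : ∀ z ∈ U, (φ z).im = 0 → φ z = 0 := by
    intro z hz him
    by_contra hne
    have hr : φ z = ((φ z).re : ℂ) := by apply Complex.ext <;> simp [him]
    have hre : ((φ z).re : ℂ) ≠ 0 := by rw [← hr]; exact hne
    apply hst (-((φ z).re)⁻¹) z hz
    have : h.eval z = ((φ z).re : ℂ) * q.eval z := by
      rw [← hr]; exact (div_mul_cancel₀ _ (hq0 z hz)).symm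
    rw [this, Complex.ofReal_neg, Complex.ofReal_inv, neg_mul, inv_mul_cancel_left₀ hre]
    exact add_neg_cancel _
  obtain ⟨z₀, hz₀, hneg⟩ := exists_im_div_neg hq hq1 hh hα
  have hφc : ContinuousOn φ U := h.continuous.continuousOn.div q.continuous.continuousOn hq0
  have hφan : AnalyticOnNhd ℂ φ U := by
    intro z hz
    exact (AnalyticOnNhd.eval_polynomial h z trivial).div
      (AnalyticOnNhd.eval_polynomial q z trivial) (hq0 z hz)
  have hne : ∀ z ∈ U, (φ z).im ≠ 0 := by
    rcases hφan.is_constant_or_isOpen hUc with ⟨w, hw⟩ | hopen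
    · intro z hz
      rw [hw z hz, ← hw z₀ hz₀]
      exact hneg.ne
    · intro z hz him
      -- An open image containing 0 would also contain small positive reals, which are not values of
      -- `φ`.
      have h0 := hreal z hz him
      have himg : IsOpen (φ '' U) := hopen U subset_rfl hUo
      have hmem : (0 : ℂ) ∈ φ '' U := ⟨z, hz, h0⟩
      obtain ⟨ε, hε, hball⟩ := Metric.isOpen_iff.1 himg 0 hmem
      have : ((ε / 2 : ℝ) : ℂ) ∈ φ '' U := hball (by
        rw [Metric.mem_ball, dist_zero_right, Complex.norm_real, Real.norm_of_nonneg (by positivity)]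
        linarith)
      obtain ⟨w, hw, hww⟩ := this
      have := hreal w hw (by rw [hww, Complex.ofReal_im])
      rw [hww] at this
      have : ε / 2 = 0 := by exact_mod_cast this
      linarith
  by_contra hcon
  push Not at hcon
  have himc : ContinuousOn (fun z => (φ z).im) U := Complex.continuous_im.comp_continuousOn hφc
  obtain ⟨w, hw, hw0⟩ := hUc.intermediate_value hz₀ hz himc ⟨hneg.le, hcon⟩
  exact hne w hw hw0

/-! ### Rank-one stability and its preservation under averaging. -/

/-- Families of polynomials, indexed by tuples of matrices, that behave like the characteristic
polynomial of the sum of the tuple with respect to Hermitian rank-one perturbations. -/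
structure RankOneStable {ι n : Type*} [Fintype ι] [DecidableEq ι] [Fintype n]
    (F : (ι → Matrix n n ℂ) → ℂ[X]) : Prop where
  natDegree_le : ∀ X, (F X).natDegree ≤ Fintype.card n
  coeff_card : ∀ X, (F X).coeff (Fintype.card n) = 1
  coeff_pred : ∀ m, Fintype.card n = m + 1 → ∀ X, (F X).coeff m = -∑ k, (X k).trace
  affine : ∀ X k (u : n → ℂ) (t : ℂ),
    F (Function.update X k (X k + t • Matrix.vecMulVec u (star u))) =
      F X + C t * (F (Function.update X k (X k + Matrix.vecMulVec u (star u))) - F X)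
  eval_ne_zero : ∀ X, (∀ k, (X k).IsHermitian) → ∀ z : ℂ, 0 < z.im → (F X).eval z ≠ 0

theorem rankOneStable_charpoly_sum {ι n : Type*} [Fintype ι] [DecidableEq ι] [Fintype n]
    [DecidableEq n] :
    RankOneStable (fun X : ι → Matrix n n ℂ => (∑ k, X k).charpoly) where
  natDegree_le X := (Matrix.charpoly_natDegree_eq_dim _).le
  coeff_card X := by
    conv_lhs => rw [← Matrix.charpoly_natDegree_eq_dim (∑ k, X k)]
    exact Matrix.charpoly_monic _
  coeff_pred m hm X := by
    have : Nonempty n := Fintype.card_pos_iff.1 (by omega)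
    rw [← Matrix.trace_sum, Matrix.trace_eq_neg_charpoly_coeff, hm]
    simp
  affine X k u t := by
    have h : ∀ D : Matrix n n ℂ,
        ∑ i, Function.update X k (X k + D) i = ∑ i, X i + D := by
      intro D
      rw [Finset.sum_update_of_mem (Finset.mem_univ k),
        Finset.sum_eq_add_sum_sdiff_singleton_of_mem (Finset.mem_univ k) X]
      abel
    simp only [h]
    exact Matrix.charpoly_add_smul_vecMulVec _ _ _ _
  eval_ne_zero X hX z hz := by
    refine Matrix.IsHermitian.charpoly_eval_ne_zero ?_ hz.ne'
    exact isSelfAdjoint_sum _ fun k _ => hX k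

theorem Matrix.isHermitian_vecMulVec_star {n : Type*} (u : n → ℂ) :
    (vecMulVec u (star u)).IsHermitian := by
  ext i j; simp [vecMulVec_apply, mul_comm]

-- With `r` the polynomial of the perturbed tuple, affineness identifies `F Y + t (r - F Y)` with
-- `F` at the Hermitian tuple perturbed by `-t u uᴴ`. The pencil lemma therefore applies to `h = r -
-- F Y`.
open scoped ComplexOrder in
theorem RankOneStable.div_eq_one_or_im_neg {ι n : Type*} [Fintype ι] [DecidableEq ι] [Fintype n]
    {F : (ι → Matrix n n ℂ) → ℂ[X]} (hF : RankOneStable F) {Y : ι → Matrix n n ℂ}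
    (hY : ∀ k, (Y k).IsHermitian) (k : ι) (u : n → ℂ) {z : ℂ} (hz : 0 < z.im) :
    (F (Function.update Y k (Y k - Matrix.vecMulVec u (star u)))).eval z / (F Y).eval z = 1 ∨
    ((F (Function.update Y k (Y k - Matrix.vecMulVec u (star u)))).eval z / (F Y).eval z).im
      < 0 := by
  have hq0 := hF.eval_ne_zero Y hY z hz
  by_cases hu : u = 0
  · left; simp [hu, hq0]
  right
  set r := F (Function.update Y k (Y k - Matrix.vecMulVec u (star u))) with hr
  obtain ⟨m, hm⟩ : ∃ m, Fintype.card n = m + 1 := by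
    obtain ⟨i, -⟩ := Function.ne_iff.1 hu
    have : Nonempty n := ⟨i⟩
    exact Nat.exists_eq_succ_of_ne_zero Fintype.card_ne_zero
  have hr1 : r = F Y - (F (Function.update Y k (Y k + Matrix.vecMulVec u (star u))) - F Y) := by
    have := hF.affine Y k u (-1)
    rw [neg_smul, one_smul, ← sub_eq_add_neg] at this
    rw [hr, this]; simp; ring
  -- The top coefficients cancel; the next ones differ by the trace of `u uᴴ`, which makes the
  -- leading coefficient of `h` positive.
  have hcoeff : (r - F Y).coeff m = u ⬝ᵥ star u := by
    rw [coeff_sub, hr, hF.coeff_pred m hm, hF.coeff_pred m hm,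
      Finset.sum_eq_add_sum_sdiff_singleton_of_mem (Finset.mem_univ k),
      Finset.sum_eq_add_sum_sdiff_singleton_of_mem (Finset.mem_univ k) (fun i => (Y i).trace)]
    rw [Finset.sum_congr rfl (g := fun i => (Y i).trace) (s₁ := Finset.univ \ {k})]
    · simp [Matrix.trace_sub, Matrix.trace_vecMulVec]
    · intro i hi
      simp at hi
      simp [hi]
  have hpos : 0 < ((r - F Y).coeff m).re := by
    rw [hcoeff]
    have := Matrix.dotProduct_self_star_pos_iff.2 hu
    exact (Complex.lt_def.1 this).1
  have hdeg : (r - F Y).natDegree ≤ m := by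
    rw [natDegree_le_iff_coeff_eq_zero]
    intro j hj
    rcases (Nat.succ_le_of_lt hj).eq_or_lt with h | h
    · rw [← h, Nat.succ_eq_add_one, ← hm, coeff_sub, hr, hF.coeff_card, hF.coeff_card, sub_self]
    · rw [coeff_sub, hr, coeff_eq_zero_of_natDegree_lt, coeff_eq_zero_of_natDegree_lt, sub_self]
      · exact (hF.natDegree_le _).trans_lt (by omega)
      · exact (hF.natDegree_le _).trans_lt (by omega)
  have key := im_div_neg_of_pencil (q := F Y) (h := r - F Y) (n := m)
    (hm ▸ hF.natDegree_le Y) (hm ▸ hF.coeff_card Y) hdeg hpos (fun t w hw => by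
      have h1 := hF.affine Y k u (-(t : ℂ))
      have h2 := hF.eval_ne_zero
        (Function.update Y k (Y k + (-(t : ℂ)) • Matrix.vecMulVec u (star u))) (by
          intro i
          rcases eq_or_ne i k with rfl | hi
          · rw [Function.update_self]
            refine (hY i).add ?_
            rw [← Complex.ofReal_neg]
            have := Matrix.isHermitian_vecMulVec_star u
            unfold Matrix.IsHermitian at this ⊢
            rw [Matrix.conjTranspose_smul, this]; simp
          · rw [Function.update_of_ne hi]; exact hY i) w hw
      rw [h1] at h2
      convert h2 using 1
      rw [hr1]
      simp only [eval_add, eval_sub, eval_mul, eval_C]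
      ring) hz
  rwa [eval_sub, sub_div, div_self hq0, Complex.sub_im, Complex.one_im, sub_zero] at key

/-- With `m = star l`, the change is `-(y mᴴ + m yᴴ)`, where `y` absorbs half of the real quadratic
term `κ m mᴴ`. Polarization writes it as half the difference of the squares of `y - m` and `y + m`.
-/
theorem Matrix.conj_one_sub_vecMulVec {n : Type*} [Fintype n] [DecidableEq n] (w l : n → ℂ)
    {X : Matrix n n ℂ} (hX : X.IsHermitian) :
    ∃ a b : n → ℂ, (1 - vecMulVec w l)ᴴ * X * (1 - vecMulVec w l) =
      X + vecMulVec a (star a) - vecMulVec b (star b) := by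
  set κ : ℂ := star w ⬝ᵥ (X *ᵥ w) with hκ
  have hκs : star κ = κ := by
    rw [hκ, ← Matrix.star_dotProduct, Matrix.star_mulVec, hX.eq, ← Matrix.dotProduct_mulVec]
  set m : n → ℂ := star l with hm
  set y : n → ℂ := X *ᵥ w - (κ / 2) • m with hy
  set c : ℂ := ((√2 : ℝ) : ℂ)⁻¹ with hc
  have hcc : c * star c = 1 / 2 := by
    rw [hc, ← Complex.ofReal_inv]
    simp only [Complex.star_def, Complex.conj_ofReal]
    rw [← Complex.ofReal_mul, ← mul_inv, Real.mul_self_sqrt (by norm_num)]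
    norm_num
  refine ⟨c • (y - m), c • (y + m), ?_⟩
  have hl : l = star m := by simp [hm]
  have h2 : vecMulVec (c • (y - m)) (star (c • (y - m))) -
      vecMulVec (c • (y + m)) (star (c • (y + m))) =
      - (vecMulVec y (star m) + vecMulVec m (star y)) := by
    ext i j
    simp only [vecMulVec_apply, Matrix.sub_apply, Pi.smul_apply, Pi.star_apply, Pi.sub_apply,
      Pi.add_apply, smul_eq_mul, star_mul', star_sub, star_add, Matrix.neg_apply, Matrix.add_apply]
    linear_combination (-2 * (y i * star (m j) + m i * star (y j))) * hcc
  rw [add_sub_assoc, h2, hl]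
  have h3 : (1 - vecMulVec w (star m))ᴴ = 1 - vecMulVec m (star w) := by
    rw [conjTranspose_sub, conjTranspose_one, conjTranspose_vecMulVec, star_star]
  have h4 : star (X *ᵥ w) = star w ᵥ* X := by rw [Matrix.star_mulVec, hX.eq]
  have h5 : star (κ / 2) = κ / 2 := by rw [star_div₀, hκs]; simp
  rw [h3, sub_mul, one_mul, mul_sub, mul_one, sub_mul, Matrix.mul_vecMulVec,
    Matrix.vecMulVec_mul, Matrix.vecMulVec_mul_vecMulVec, hy, star_sub, star_smul, h4, h5,
    ← Matrix.dotProduct_mulVec, ← hκ]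
  ext i j
  simp only [vecMulVec_apply, Matrix.sub_apply, Pi.smul_apply, Pi.star_apply, Pi.sub_apply,
      smul_eq_mul, Matrix.neg_apply, Matrix.add_apply]
  ring

/-- Conjugation sends `u uᴴ` to `(Bᴴ u)(Bᴴ u)ᴴ`, preserving affineness, and unitarity preserves
traces. Stability comes from comparing both terms with the common tuple `Y`. -/
theorem RankOneStable.step {ι n : Type*} [Fintype ι] [DecidableEq ι] [Fintype n] [DecidableEq n]
    {F : (ι → Matrix n n ℂ) → ℂ[X]} (hF : RankOneStable F) (B : ι → Matrix n n ℂ)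
    (hB : ∀ k, B k * (B k)ᴴ = 1) (k₀ : ι) (hB₀ : ∃ w l, B k₀ = 1 - Matrix.vecMulVec w l)
    (hB₁ : ∀ k, k ≠ k₀ → B k = 1) (θ : unitInterval) :
    RankOneStable (fun X => C ((1 - θ : ℝ) : ℂ) * F X +
      C ((θ : ℝ) : ℂ) * F (fun k => (B k)ᴴ * X k * B k)) where
  natDegree_le X := natDegree_add_le_of_degree_le
    ((natDegree_C_mul_le _ _).trans (hF.natDegree_le _))
    ((natDegree_C_mul_le _ _).trans (hF.natDegree_le _))
  coeff_card X := by
    simp only [coeff_add, coeff_C_mul, hF.coeff_card]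
    push_cast; ring
  coeff_pred m hm X := by
    simp only [coeff_add, coeff_C_mul, hF.coeff_pred m hm]
    have : ∀ k, ((B k)ᴴ * X k * B k).trace = (X k).trace := by
      intro k
      rw [Matrix.trace_mul_comm, ← mul_assoc, hB, one_mul]
    simp only [this]
    push_cast; ring
  affine X k u t := by
    have h : ∀ D : Matrix n n ℂ, (fun i => (B i)ᴴ * Function.update X k (X k + D) i * B i) =
        Function.update (fun i => (B i)ᴴ * X i * B i) k
          ((B k)ᴴ * X k * B k + (B k)ᴴ * D * B k) := by
      intro D
      ext1 i
      rcases eq_or_ne i k with rfl | hi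
      · simp [mul_add, add_mul]
      · simp [hi]
    have h2 : ∀ t : ℂ, (B k)ᴴ * (t • Matrix.vecMulVec u (star u)) * B k =
        t • Matrix.vecMulVec ((B k)ᴴ *ᵥ u) (star ((B k)ᴴ *ᵥ u)) := by
      intro t
      rw [Matrix.mul_smul, Matrix.smul_mul, Matrix.mul_vecMulVec, Matrix.vecMulVec_mul,
        Matrix.star_mulVec, Matrix.conjTranspose_conjTranspose]
    have h3 := h2 1
    rw [one_smul, one_smul] at h3
    simp only [h, h2, h3]
    have e1 := hF.affine X k u t
    have e2 := hF.affine (fun i => (B i)ᴴ * X i * B i) k ((B k)ᴴ *ᵥ u) t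
    rw [e1, e2]
    ring
  eval_ne_zero X hX z hz := by
    obtain ⟨w, l, hwl⟩ := hB₀
    obtain ⟨a, b, hab⟩ := Matrix.conj_one_sub_vecMulVec w l (hX k₀)
    set Y := Function.update X k₀ (X k₀ + Matrix.vecMulVec a (star a)) with hYdef
    have hY : ∀ k, (Y k).IsHermitian := by
      intro k
      rcases eq_or_ne k k₀ with rfl | hk
      · rw [hYdef, Function.update_self]
        exact (hX k).add (Matrix.isHermitian_vecMulVec_star a)
      · rw [hYdef, Function.update_of_ne hk]; exact hX k
    have hXY : Function.update Y k₀ (Y k₀ - Matrix.vecMulVec a (star a)) = X := by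
      simp [hYdef]
    have hBY : Function.update Y k₀ (Y k₀ - Matrix.vecMulVec b (star b)) =
        fun k => (B k)ᴴ * X k * B k := by
      ext1 k
      rcases eq_or_ne k k₀ with rfl | hk
      · rw [Function.update_self, hYdef, Function.update_self, hwl, hab]
      · simp [hYdef, hk, hB₁ k hk]
    have h1 := hF.div_eq_one_or_im_neg hY k₀ a hz
    have h2 := hF.div_eq_one_or_im_neg hY k₀ b hz
    rw [hXY] at h1
    rw [hBY] at h2
    have hq0 := hF.eval_ne_zero Y hY z hz
    set p := (F X).eval z / (F Y).eval z
    set r := (F (fun k => (B k)ᴴ * X k * B k)).eval z / (F Y).eval z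
    intro h0
    have h3 : ((1 - θ : ℝ) : ℂ) * p + ((θ : ℝ) : ℂ) * r = 0 := by
      have : (((1 - θ : ℝ) : ℂ) * (F X).eval z + ((θ : ℝ) : ℂ) *
          (F (fun k => (B k)ᴴ * X k * B k)).eval z) / (F Y).eval z = 0 := by
        rw [← zero_div ((F Y).eval z)]
        congr 1
        simpa only [eval_add, eval_mul, eval_C] using h0
      rw [← this, add_div, mul_div_assoc, mul_div_assoc]
    have hre := congrArg Complex.re h3
    have him := congrArg Complex.im h3
    simp only [Complex.add_re, Complex.add_im, Complex.re_ofReal_mul, Complex.im_ofReal_mul,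
      Complex.zero_re, Complex.zero_im] at hre him
    have hθ0 := θ.2.1
    have hθ1 := θ.2.2
    -- A ratio equal to 1 is real, so a vanishing imaginary part forces the other weight to be 0;
    -- the real part is then 1.
    rcases h1 with h1 | h1 <;> rcases h2 with h2 | h2
    · rw [h1, h2] at hre; simp at hre
    · rw [h1] at hre him
      simp only [Complex.one_im, Complex.one_re, mul_zero, zero_add, mul_one] at hre him
      rcases mul_eq_zero.1 him with h | h
      · rw [h] at hre; simp at hre
      · exact h2.ne h
    · rw [h2] at hre him
      simp only [Complex.one_im, Complex.one_re, mul_zero, add_zero, mul_one] at hre him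
      rcases mul_eq_zero.1 him with h | h
      · rw [h] at hre; linarith
      · exact h1.ne h
    · rcases hθ0.eq_or_lt with h | h
      · rw [← h] at him
        simp only [sub_zero, one_mul, zero_mul, add_zero] at him
        exact h1.ne him
      · have e1 := mul_neg_of_pos_of_neg h h2
        have e2 := mul_nonneg_of_nonpos_of_nonpos h1.le (by linarith : (θ : ℝ) - 1 ≤ 0)
        linarith

/-! ### Expectations over independent bits. -/

theorem sum_bernoulliProdWeight {ι : Type*} [Fintype ι] [DecidableEq ι] (b : ι → unitInterval) :
    ∑ s, bernoulliProdWeight b s = 1 := by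
  unfold bernoulliProdWeight
  rw [← Fintype.prod_sum (fun i (x : Bool) => if x then (b i : ℝ) else 1 - (b i : ℝ))]
  simp

theorem expectedPoly_const {ι : Type*} [Fintype ι] [DecidableEq ι] (b : ι → unitInterval)
    (p : ℂ[X]) : expectedPoly b (fun _ => p) = p := by
  unfold expectedPoly
  rw [← Finset.sum_mul, ← map_sum, ← Complex.ofReal_sum, sum_bernoulliProdWeight]
  simp

/-- Conditioning the expectation on the value of one bit. -/
theorem expectedPoly_condition {ι : Type*} [Fintype ι] [DecidableEq ι] (b : ι → unitInterval)
    (F : (ι → Bool) → ℂ[X]) (i : ι) :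
    expectedPoly b F =
      C ((1 - b i : ℝ) : ℂ) * expectedPoly b (fun s => F (Function.update s i false)) +
      C ((b i : ℝ) : ℂ) * expectedPoly b (fun s => F (Function.update s i true)) := by
  set e := (Equiv.funSplitAt i Bool).symm with he
  set w' : ({j // j ≠ i} → Bool) → ℝ :=
    fun s => ∏ j : {j // j ≠ i}, if s j then (b j : ℝ) else 1 - (b j : ℝ) with hw'
  have hw : ∀ x s, bernoulliProdWeight b (e (x, s)) =
      (if x then (b i : ℝ) else 1 - (b i : ℝ)) * w' s := by
    intro x s
    unfold bernoulliProdWeight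
    rw [Fintype.prod_eq_mul_prod_subtype_ne _ i]
    congr 1
    · simp [he, Equiv.funSplitAt]
    · refine Finset.prod_congr rfl fun j _ => ?_
      simp [he, Equiv.funSplitAt, j.2]
  have hup : ∀ x y s, Function.update (e (x, s)) i y = e (y, s) := by
    intro x y s
    ext1 j
    rcases eq_or_ne j i with rfl | hj
    · simp [he, Equiv.funSplitAt]
    · simp [he, Equiv.funSplitAt, hj]
  have hsum : ∀ G : (ι → Bool) → ℂ[X], expectedPoly b G =
      ∑ s, C (w' s : ℂ) * (C ((1 - b i : ℝ) : ℂ) * G (e (false, s)) +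
        C ((b i : ℝ) : ℂ) * G (e (true, s))) := by
    intro G
    unfold expectedPoly
    rw [← e.sum_comp, Fintype.sum_prod_type, Fintype.sum_bool, ← Finset.sum_add_distrib]
    refine Finset.sum_congr rfl fun s _ => ?_
    rw [hw, hw]
    simp only [if_true, Bool.false_eq_true, if_false, Complex.ofReal_mul, map_mul]
    ring
  rw [hsum, hsum, hsum, Finset.mul_sum, Finset.mul_sum, ← Finset.sum_add_distrib]
  refine Finset.sum_congr rfl fun s _ => ?_
  simp only [hup]
  push_cast
  simp only [map_sub, map_one]
  ring

/-- The expectation of `f` at a random product of `R i`, `i` running through a list, each factor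
being independently kept with probability `b i`. -/
noncomputable def nestedExpectation {ι G : Type*} [Monoid G] (b : ι → unitInterval) (R : ι → G) :
    List ι → (G → ℂ[X]) → ℂ[X]
  | [], f => f 1
  | i :: L, f => C ((1 - b i : ℝ) : ℂ) * nestedExpectation b R L f +
      C ((b i : ℝ) : ℂ) * nestedExpectation b R L (fun g => f (R i * g))

/-- Since no bit repeats in `L`, conditioning on the head leaves the tail product unchanged; bits
outside `L` average out. -/
theorem expectedPoly_prod_eq_nestedExpectation {ι G : Type*} [Fintype ι] [DecidableEq ι] [Monoid G]
    (b : ι → unitInterval) (R : ι → G) {L : List ι} (hL : L.Nodup) (f : G → ℂ[X]) :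
    expectedPoly b (fun s => f (L.map fun i => if s i then R i else 1).prod) =
      nestedExpectation b R L f := by
  induction L generalizing f with
  | nil => simpa [nestedExpectation] using expectedPoly_const b (f 1)
  | cons i L ih =>
    obtain ⟨hi, hL⟩ := List.nodup_cons.1 hL
    have h : ∀ (s : ι → Bool) y, (L.map fun k => if Function.update s i y k then R k else 1) =
        L.map fun k => if s k then R k else 1 := by
      intro s y
      refine List.map_congr_left fun k hk => ?_
      rw [Function.update_of_ne (ne_of_mem_of_not_mem hk hi)]
    rw [expectedPoly_condition b _ i, nestedExpectation, ← ih hL, ← ih hL]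
    simp [h]

/-- The leftmost factor acts on `X` innermost: prepending `R i` replaces each `X k` by its conjugate
under `U k (R i)` inside the expectation for the tail. This is why stability is proved for all
tuples `X` at once. -/
theorem rankOneStable_nestedExpectation {ι κ n G : Type*} [Fintype κ] [DecidableEq κ] [Fintype n]
    [DecidableEq n] [Monoid G] (b : ι → unitInterval) (R : ι → G) (U : κ → G →* Matrix n n ℂ)
    (hU : ∀ i k, U k (R i) * (U k (R i))ᴴ = 1)
    (hR : ∀ i, ∃ k₀, (∃ w l, U k₀ (R i) = 1 - Matrix.vecMulVec w l) ∧
      ∀ k, k ≠ k₀ → U k (R i) = 1) (L : List ι) :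
    RankOneStable (fun X : κ → Matrix n n ℂ => nestedExpectation b R L
      (fun g => (∑ k, (U k g)ᴴ * X k * U k g).charpoly)) := by
  induction L with
  | nil => simpa [nestedExpectation] using rankOneStable_charpoly_sum
  | cons i L ih =>
    obtain ⟨k₀, h₀, h₁⟩ := hR i
    have := ih.step (fun k => U k (R i)) (hU i) k₀ h₀ h₁ (b i)
    simpa only [nestedExpectation, map_mul, Matrix.conjTranspose_mul, mul_assoc] using this

theorem realRooted_of_eval_ne_zero {p : ℂ[X]} (hreal : ∀ k, (p.coeff k).im = 0)
    (h : ∀ z : ℂ, 0 < z.im → p.eval z ≠ 0) : RealRooted p := by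
  refine ⟨fun h0 => h Complex.I (by simp) (by simp [h0]), hreal, fun z hz => ?_⟩
  rcases lt_trichotomy z.im 0 with hneg | h0 | hpos
  · exfalso
    apply h (starRingEnd ℂ z) (by simpa using hneg)
    have hp : p.map (starRingEnd ℂ) = p := by
      ext k
      rw [coeff_map]
      exact Complex.conj_eq_iff_im.2 (hreal k)
    rw [← hp, eval_map_apply, hz, map_zero]
  · exact h0
  · exact absurd hz (h z hpos)

/-! ### The lifted adjacency matrices -/

theorem outerTensor_apply {V Γ : Type*} [Fintype V] [DecidableEq V] [Group Γ] {d : ℕ}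
    (π : Γ →* Matrix.unitaryGroup (Fin d) ℂ) (Q : V → Γ) (v v' : V) (a b : Fin d) :
    outerTensor π Q (v, a) (v', b) =
      if v = v' then (π (Q v) : Matrix (Fin d) (Fin d) ℂ) a b else 0 := by
  unfold outerTensor
  rw [Matrix.sum_apply]
  simp only [Matrix.kroneckerMap_apply, Matrix.single_apply]
  rw [Finset.sum_eq_single v]
  · simp
  · intro u _ hu; simp [hu]
  · simp

/-- `outerTensor` as a homomorphism. -/
noncomputable def outerTensorHom {V Γ : Type*} [Fintype V] [DecidableEq V] [Group Γ] {d : ℕ}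
    (π : Γ →* Matrix.unitaryGroup (Fin d) ℂ) : (V → Γ) →* Matrix (V × Fin d) (V × Fin d) ℂ where
  toFun := outerTensor π
  map_one' := by
    ext ⟨v, a⟩ ⟨v', b⟩
    rw [outerTensor_apply]
    by_cases h : v = v' <;> simp [Matrix.one_apply, h]
  map_mul' P Q := by
    ext ⟨v, a⟩ ⟨v', b⟩
    rw [Matrix.mul_apply, Fintype.sum_prod_type]
    simp only [outerTensor_apply]
    rw [Finset.sum_eq_single v]
    · by_cases h : v = v'
      · simp [h, Matrix.mul_apply]
      · simp [h]
    · intro u _ hu; simp [hu.symm]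
    · simp

theorem conjTranspose_outerTensor {V Γ : Type*} [Fintype V] [DecidableEq V] [Group Γ] {d : ℕ}
    (π : Γ →* Matrix.unitaryGroup (Fin d) ℂ) (Q : V → Γ) :
    (outerTensor π Q)ᴴ = outerTensor π Q⁻¹ := by
  ext ⟨v, a⟩ ⟨v', b⟩
  rw [Matrix.conjTranspose_apply, outerTensor_apply, outerTensor_apply]
  by_cases h : v = v'
  · subst h
    simp [Matrix.star_apply]
  · simp [h, Ne.symm h]

theorem outerTensor_mul_conjTranspose {V Γ : Type*} [Fintype V] [DecidableEq V] [Group Γ] {d : ℕ}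
    (π : Γ →* Matrix.unitaryGroup (Fin d) ℂ) (Q : V → Γ) :
    outerTensor π Q * (outerTensor π Q)ᴴ = 1 := by
  rw [conjTranspose_outerTensor]
  have := (outerTensorHom π).map_mul Q Q⁻¹
  rw [mul_inv_cancel, map_one] at this
  exact this.symm

theorem isHermitian_sumGraph_liftAdj {V Γ : Type*} [Fintype V] [DecidableEq V] [Group Γ] {c d : ℕ}
    (H : SumGraph V c) (π : Γ →* Matrix.unitaryGroup (Fin d) ℂ) (Q : Fin c → V → Γ) :
    (H.liftAdj π Q).IsHermitian := by
  refine isSelfAdjoint_sum _ fun j _ => ?_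
  refine Matrix.isHermitian_conjTranspose_mul_mul _ ?_
  rw [Matrix.IsHermitian, Matrix.conjTranspose_kronecker, H.isHermitian j,
    Matrix.conjTranspose_one]

/-- Only the block at `v₀` differs from the identity, so the perturbation keeps rank at most one
after the lift. -/
theorem outerTensor_ite {V Γ : Type*} [Fintype V] [DecidableEq V] [Group Γ] {d : ℕ}
    (π : Γ →* Matrix.unitaryGroup (Fin d) ℂ) {τ : Γ} {w l : Fin d → ℂ}
    (hτ : (π τ : Matrix (Fin d) (Fin d) ℂ) = 1 - Matrix.vecMulVec w l) (v₀ : V) :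
    outerTensor π (fun v => if v₀ = v then τ else 1) = 1 - Matrix.vecMulVec
      (fun p : V × Fin d => if v₀ = p.1 then w p.2 else 0)
      (fun p : V × Fin d => if v₀ = p.1 then l p.2 else 0) := by
  ext ⟨v, a⟩ ⟨v', b⟩
  rw [outerTensor_apply, Matrix.sub_apply, Matrix.vecMulVec_apply, Matrix.one_apply]
  by_cases h : v = v'
  · subst h
    by_cases h0 : v₀ = v
    · simp [h0, hτ, Matrix.one_apply, Matrix.vecMulVec_apply]
    · simp [h0, Matrix.one_apply]
  · by_cases h0 : v₀ = v
    · subst h0; simp [h]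
    · simp [h, h0]

/-! ### Transpositions act as rank-one perturbations of the identity -/

theorem exists_eq_one_sub_vecMulVec_of_equiv {N d : ℕ} {W : Type*} [AddCommGroup W] [Module ℂ W]
    {π : Equiv.Perm (Fin N) →* Matrix.unitaryGroup (Fin d) ℂ}
    {ρ : Representation ℂ (Equiv.Perm (Fin N)) W} (φ : (unitaryRep π).Equiv ρ)
    (τ : Equiv.Perm (Fin N)) (w : W) (l : W →ₗ[ℂ] ℂ) (h : ∀ x, ρ τ x = x - l x • w) :
    ∃ w' l', (π τ : Matrix (Fin d) (Fin d) ℂ) = 1 - Matrix.vecMulVec w' l' := by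
  have key : ∀ x : Fin d → ℂ, (π τ : Matrix (Fin d) (Fin d) ℂ) *ᵥ x =
      x - l (φ.toLinearEquiv x) • φ.toLinearEquiv.symm w := by
    intro x
    apply φ.toLinearEquiv.injective
    have h1 := φ.toIntertwiningMap.isIntertwining _ _ τ x
    rw [map_sub, map_smul, LinearEquiv.apply_symm_apply, ← h]
    exact h1
  refine ⟨φ.toLinearEquiv.symm w, fun b => l (φ.toLinearEquiv (Pi.single b 1)), ?_⟩
  ext a b
  have := congrFun (key (Pi.single b 1)) a
  rw [Matrix.mulVec_single_one, Matrix.col_apply] at this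
  rw [this]
  simp [Matrix.vecMulVec_apply, Matrix.one_apply, Pi.single_apply, mul_comm]

theorem permRep_swap_apply {N : ℕ} (i j : Fin N) (x : Fin N → ℂ) :
    permRep N (Equiv.swap i j) x = x - (x i - x j) • (Pi.single i 1 - Pi.single j 1) := by
  ext k
  change x ((Equiv.swap i j)⁻¹ k) = _
  rw [Equiv.swap_inv, Equiv.swap_apply_def]
  simp only [Pi.sub_apply, Pi.smul_apply, Pi.single_apply, smul_eq_mul]
  split_ifs <;> simp_all

/-- For `sgn` the space is one-dimensional. For the other two, a swap subtracts `(x i - x j)(e i - e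
j)`, and `e i - e j` has coordinate sum zero. -/
theorem IsSgnStdOrPerm.exists_swap_eq {N d : ℕ}
    {π : Equiv.Perm (Fin N) →* Matrix.unitaryGroup (Fin d) ℂ} (hπ : IsSgnStdOrPerm π)
    (i j : Fin N) :
    ∃ w l, (π (Equiv.swap i j) : Matrix (Fin d) (Fin d) ℂ) = 1 - Matrix.vecMulVec w l := by
  rcases hπ with ⟨⟨φ⟩⟩ | ⟨⟨φ⟩⟩ | ⟨⟨φ⟩⟩
  · refine exists_eq_one_sub_vecMulVec_of_equiv φ _ 1
      (LinearMap.id - sgnRep N (Equiv.swap i j)) fun x => ?_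
    simp
  · refine exists_eq_one_sub_vecMulVec_of_equiv φ _
      ⟨Pi.single i 1 - Pi.single j 1, by simp [sumZeroSubrep]⟩
      ((LinearMap.proj (R := ℂ) (φ := fun _ => ℂ) i - LinearMap.proj j) ∘ₗ Submodule.subtype _)
      fun x => ?_
    apply Subtype.ext
    exact permRep_swap_apply i j x
  · exact exists_eq_one_sub_vecMulVec_of_equiv φ _ (Pi.single i 1 - Pi.single j 1)
      (LinearMap.proj (R := ℂ) (φ := fun _ => ℂ) i - LinearMap.proj j) (permRep_swap_apply i j)

/-! ### Encodings as products over a list of bits -/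

/-- The pairs `i < j` in lexicographic order. -/
def transpIndexList (N : ℕ) : List (TranspIndex N) :=
  (List.finRange N).flatMap fun i => (List.finRange N).filterMap fun j =>
    if h : i < j then some ⟨(i, j), h⟩ else none

theorem nodup_transpIndexList (N : ℕ) : (transpIndexList N).Nodup := by
  refine List.nodup_flatMap.2 ⟨fun i _ => ?_, ?_⟩
  · refine (List.nodup_finRange N).filterMap fun j j' e he he' => ?_
    simp only [Option.mem_def, Option.dite_none_right_eq_some, Option.some.injEq] at he he'
    obtain ⟨_, rfl⟩ := he
    obtain ⟨_, he'⟩ := he'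
    exact (congrArg (fun e => e.1.2) he').symm
  · refine (List.nodup_finRange N).imp fun {i i'} hne e he he' => hne ?_
    simp only [List.mem_filterMap, Option.dite_none_right_eq_some, Option.some.injEq] at he he'
    obtain ⟨j, _, _, rfl⟩ := he
    obtain ⟨j', _, _, he'⟩ := he'
    exact (congrArg (fun e => e.1.1) he').symm

theorem encPerm_eq_prod {N : ℕ} (x : TranspIndex N → Bool) :
    encPerm x = ((transpIndexList N).map
      fun e => if x e then Equiv.swap e.1.1 e.1.2 else 1).prod := by
  have h : ∀ (i : Fin N) (l : List (Fin N)),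
      ((l.filterMap fun j => if h : i < j then some (⟨(i, j), h⟩ : TranspIndex N) else none).map
        fun e => if x e then Equiv.swap e.1.1 e.1.2 else 1).prod =
      (l.map fun j => if h : i < j then swapBit i j (x ⟨(i, j), h⟩) else 1).prod := by
    intro i l
    induction l with
    | nil => rfl
    | cons j l ih =>
      by_cases hij : i < j
      · simp [hij, ih, swapBit]
      · simp [hij, ih]
  unfold encPerm transpIndexList
  rw [List.map_flatMap, List.flatMap_def, List.prod_flatten, List.map_map]
  simp only [Function.comp_def, h]

/-- All the bits, ordered so that the bits of each potential value come in lexicographic order. -/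
noncomputable def bitList (V : Type*) [Fintype V] (c N : ℕ) : List (Fin c × V × TranspIndex N) :=
  (Finset.univ : Finset (Fin c × V)).toList.flatMap fun p =>
    (transpIndexList N).map fun e => (p.1, p.2, e)

theorem nodup_bitList (V : Type*) [Fintype V] (c N : ℕ) : (bitList V c N).Nodup := by
  refine List.nodup_flatMap.2 ⟨fun p _ => ?_, ?_⟩
  · exact (nodup_transpIndexList N).map fun e e' h => by simpa using h
  · refine (Finset.nodup_toList _).imp fun {p p'} hne e he he' => hne ?_
    simp only [List.mem_map] at he he'
    obtain ⟨_, _, rfl⟩ := he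
    obtain ⟨_, _, he'⟩ := he'
    simp only [Prod.mk.injEq] at he'
    exact Prod.ext he'.1.symm he'.2.1.symm

/-- The tuple of potentials whose only nontrivial value is the transposition labelling a bit. -/
def bitPotential {V : Type*} [DecidableEq V] {c N : ℕ} (i : Fin c × V × TranspIndex N) :
    Fin c → V → Equiv.Perm (Fin N) :=
  fun j v => if i.1 = j then if i.2.1 = v then Equiv.swap i.2.2.1.1 i.2.2.1.2 else 1 else 1

/-- At coordinate `(j, v)` only the block of bits labelled `(j, v)` contributes, so the arbitrary
order of the blocks is harmless. -/
theorem prod_bitList {V : Type*} [Fintype V] [DecidableEq V] {c N : ℕ}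
    (s : Fin c × V × TranspIndex N → Bool) :
    ((bitList V c N).map fun i => if s i then bitPotential i else 1).prod =
      fun j => potential (encOfBits s j) := by
  funext j v
  have h1 : ((bitList V c N).map fun i => if s i then bitPotential i else 1).prod j v =
      ((bitList V c N).map fun i => (if s i then bitPotential i else 1 :
        Fin c → V → Equiv.Perm (Fin N)) j v).prod := by
    have := map_list_prod ((Pi.evalMonoidHom (fun _ : V => Equiv.Perm (Fin N)) v).comp
      (Pi.evalMonoidHom (fun _ : Fin c => V → Equiv.Perm (Fin N)) j))
      ((bitList V c N).map fun i => if s i then bitPotential i else 1)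
    rw [List.map_map] at this
    exact this
  rw [h1, bitList, List.map_flatMap, List.flatMap_def, List.prod_flatten, List.map_map,
    List.prod_map_eq_pow_single (j, v),
    @List.count_eq_one_of_mem _ instBEqOfDecidableEq _ _ _ (Finset.nodup_toList _) (by simp),
    pow_one]
  · simp only [Function.comp_apply, List.map_map]
    rw [potential, encPerm_eq_prod]
    congr 1
    refine List.map_congr_left fun e _ => ?_
    by_cases hs : s (j, v, e) <;> simp [bitPotential, encOfBits, hs]
  · rintro ⟨j', v'⟩ hne -
    simp only [Function.comp_apply, List.map_map]
    refine List.prod_eq_one fun x hx => ?_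
    obtain ⟨e, -, rfl⟩ := List.mem_map.1 hx
    simp only [Function.comp_apply]
    split_ifs
    · by_cases h : j' = j
      · by_cases h' : v' = v
        · exact absurd (by rw [h, h']) hne
        · simp [bitPotential, h']
      · simp [bitPotential, h]
    · rfl

/-! ### The interlacing family. -/

theorem mainTheorem6 {V : Type*} [Fintype V] [DecidableEq V] {c : ℕ} (H : SumGraph V c)
    {N d : ℕ} (π : Equiv.Perm (Fin N) →* Matrix.unitaryGroup (Fin d) ℂ)
    (hπ : IsSgnStdOrPerm π) :
    IsInterlacingFamily
      (fun s : Fin c × V × TranspIndex N → Bool =>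
        (H.liftAdjEnc π (encOfBits s)).charpoly) := by
  have herm : ∀ s : Fin c × V × TranspIndex N → Bool,
      (H.liftAdjEnc π (encOfBits s)).IsHermitian := fun s => isHermitian_sumGraph_liftAdj H π _
  refine ⟨fun s => realRooted_of_eval_ne_zero (herm s).charpoly_coeff_im
    fun z hz => (herm s).charpoly_eval_ne_zero hz.ne', fun b => ?_⟩
  refine realRooted_of_eval_ne_zero (fun k => ?_) ?_
  · unfold expectedPoly
    rw [finsetSum_coeff, Complex.im_sum]
    refine Finset.sum_eq_zero fun s _ => ?_
    rw [coeff_C_mul, Complex.im_ofReal_mul, (herm s).charpoly_coeff_im, mul_zero]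
  · have h := expectedPoly_prod_eq_nestedExpectation b bitPotential (nodup_bitList V c N)
      (fun Q => (H.liftAdj π Q).charpoly)
    simp only [prod_bitList] at h
    have hst := rankOneStable_nestedExpectation b bitPotential
      (fun k : Fin c => (outerTensorHom π).comp
        (Pi.evalMonoidHom (fun _ : Fin c => V → Equiv.Perm (Fin N)) k))
      (fun i k => outerTensor_mul_conjTranspose π _)
      (fun i => by
        obtain ⟨w, l, hwl⟩ := hπ.exists_swap_eq i.2.2.1.1 i.2.2.1.2
        refine ⟨i.1, ⟨_, _, Eq.trans ?_ (outerTensor_ite π hwl i.2.1)⟩, fun k hk => ?_⟩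
        · change outerTensor π (bitPotential i i.1) = _
          congr 1
          funext v
          simp [bitPotential]
        · have : bitPotential i k = 1 := by
            funext v; simp [bitPotential, hk.symm]
          rw [MonoidHom.comp_apply, Pi.evalMonoidHom_apply, this, map_one])
      (bitList V c N)
    have := hst.eval_ne_zero (fun j => H.atom j ⊗ₖ (1 : Matrix (Fin d) (Fin d) ℂ)) (fun j => by
      rw [Matrix.IsHermitian, Matrix.conjTranspose_kronecker, H.isHermitian j,
        Matrix.conjTranspose_one])
    intro z hz
    have h3 := this z hz
    change (expectedPoly b fun s => (H.liftAdj π fun j => potential (encOfBits s j)).charpoly).eval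
      z ≠ 0
    rw [h]
    exact h3
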